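/- There is a universal constant $c<\infty$ with the following property. Let $g(x)=a_dx^d+\cdots+a_1x+a_0$ be a known real polynomial of degree $d$ with $g([0,K])\subseteq[0,1]$, let $B\in\mathbb R$ be known, and let $N\ge K$ and $T$ be given. Consider $T$ rounds of the following game. Given the complete past (all earlier reward vectors, actions and feedbacks), a possibly randomized adaptive adversary chooses the law of a reward vector $v_t\in[0,1]^N$; given only the past actions and feedbacks, and conditionally independently of $v_t$ given the past, the algorithm draws a set $S_t\subseteq[N]$ with $|S_t|=K$; the algorithm then observes only a feedback $r_t\in[-B,B]$, whose conditional law given the past, $v_t$ and $S_t$ is arbitrary subject to $$\mathbb E[r_t\mid \text{past},S_t,v_t]=g\Big(\sum_{i\in S_t}v_{ti}\Big).$$ Then there is a randomized algorithm $\pi$ (which may depend on $g,N,K,T,B$) such that for every such adversary $$\max_{|S^\star|=K}\mathbb E\Big[\sum_{t=1}^T R(S^\star,v_t)-R(S_t,v_t)\Big]\le C_{g,d,K}\,\min\big\{T,\sqrt{N^dT\log N}\big\},\qquad R(S,v)=g\Big(\sum_{i\in S}v_i\Big),$$ where $C_{g,d,K}=c\,\max\{1,B\}\sqrt K$; in particular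 $C_{g,d,K}=O(\sqrt K)$ for feedback in any fixed bounded set, and $C_{g,d,K}=c\sqrt K$ for feedback in $[0,1]$. -/

import Mathlib

open MeasureTheory ProbabilityTheory
open scoped Polynomial

namespace CombBandit

/-- The actions: subsets of the `N` arms with exactly `K` elements. -/
abbrev Action (N K : ℕ) : Type := {S : Finset (Fin N) // S.card = K}

/-- Every set of actions is measurable (there are finitely many actions). -/
instance instMeasurableSpaceAction (N K : ℕ) : MeasurableSpace (Action N K) := ⊤

instance instDiscreteAction (N K : ℕ) : DiscreteMeasurableSpace (Action N K) :=
  ⟨fun _ => trivial⟩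

/-- A reward vector `v ∈ [0,1]^N`. -/
abbrev RewardVec (N : ℕ) : Type := Fin N → Set.Icc (0 : ℝ) 1

/-- Everything that happens in one period: the reward vector `v_t`, the action `S_t`,
and the feedback `r_t`. -/
abbrev Round (N K : ℕ) : Type := (RewardVec N × Action N K) × ℝ

/-- The complete record of the first `t` periods. -/
abbrev History (N K t : ℕ) : Type := Fin t → Round N K

/-- What the algorithm sees of the first `t` periods: actions and feedback. -/
abbrev Observation (N K t : ℕ) : Type := Fin t → Action N K × ℝ

/-- Forget the reward vectors. -/
def observe {N K t : ℕ} (h : History N K t) : Observation N K t :=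
  fun s => ((h s).1.2, (h s).2)

theorem measurable_observe {N K t : ℕ} :
    Measurable (observe : History N K t → Observation N K t) := by
  unfold observe
  fun_prop

/-- The mean reward `R(S, v) = g(∑_{i ∈ S} v_i)`. -/
noncomputable def meanReward {N K : ℕ} (g : ℝ[X]) (S : Action N K) (v : RewardVec N) : ℝ :=
  g.eval (∑ i ∈ S.1, (v i : ℝ))

/-- A (randomized) bandit algorithm: after `t` periods, the next action is drawn from a law that
depends measurably on the past actions and the past feedback only. -/
structure Policy (N K : ℕ) where
  action : (t : ℕ) → Kernel (Observation N K t) (Action N K)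
  isMarkov : ∀ t, IsMarkovKernel (action t)

/-- A (randomized) adaptive adversary for the link polynomial `g`, with feedback in `[-B, B]`.
After `t` periods it draws the next reward vector from a law that depends on the complete past.
Given the past, the reward vector and the action, the feedback is drawn from some law on `[-B, B]`
with mean `g(∑_{i ∈ S} v_i)`, which may also be chosen by the adversary. -/
structure Adversary (N K : ℕ) (g : ℝ[X]) (B : ℝ) where
  reward : (t : ℕ) → Kernel (History N K t) (RewardVec N)
  reward_isMarkov : ∀ t, IsMarkovKernel (reward t)
  feedback : (t : ℕ) → Kernel (History N K t × (RewardVec N × Action N K)) ℝ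
  feedback_isMarkov : ∀ t, IsMarkovKernel (feedback t)
  feedback_bounded : ∀ t h v S, ∀ᵐ r ∂(feedback t (h, (v, S))), r ∈ Set.Icc (-B) B
  feedback_mean : ∀ t h v S, ∫ r, r ∂(feedback t (h, (v, S))) = meanReward g S v

attribute [instance] Policy.isMarkov Adversary.reward_isMarkov Adversary.feedback_isMarkov

section Interaction

variable {N K : ℕ} {g : ℝ[X]} {B : ℝ}

/-- The law of the next period given the complete past: the reward vector and the action are drawn
independently of each other, then the feedback is drawn. -/
noncomputable def nextRound (π : Policy N K) (𝒜 : Adversary N K g B) (t : ℕ) :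
    Kernel (History N K t) (Round N K) :=
  (𝒜.reward t ×ₖ (π.action t).comap observe measurable_observe) ⊗ₖ 𝒜.feedback t

instance instMarkovNextRound (π : Policy N K) (𝒜 : Adversary N K g B) (t : ℕ) :
    IsMarkovKernel (nextRound π 𝒜 t) := by
  unfold nextRound
  infer_instance

/-- Append one period to a record. -/
def append {t : ℕ} (p : History N K t × Round N K) : History N K (t + 1) :=
  Fin.snoc (α := fun _ => Round N K) p.1 p.2

theorem measurable_append {t : ℕ} :
    Measurable (append : History N K t × Round N K → History N K (t + 1)) := by
  refine measurable_pi_lambda _ fun i => ?_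
  refine Fin.lastCases ?_ (fun j => ?_) i
  · simpa [append] using measurable_snd
  · simp only [append, Fin.snoc_castSucc]
    fun_prop

/-- The joint law of the first `t` periods when the algorithm `π` plays against `𝒜`. -/
noncomputable def law (π : Policy N K) (𝒜 : Adversary N K g B) : (t : ℕ) → Measure (History N K t)
  | 0 => Measure.dirac Fin.elim0
  | t + 1 => (law π 𝒜 t ⊗ₘ nextRound π 𝒜 t).map append

instance instProbabilityLaw (π : Policy N K) (𝒜 : Adversary N K g B) (t : ℕ) :
    IsProbabilityMeasure (law π 𝒜 t) := by
  induction t with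
  | zero => unfold law; infer_instance
  | succ t ih =>
    unfold law
    exact Measure.isProbabilityMeasure_map measurable_append.aemeasurable

/-- The expected regret over `T` periods against the fixed action `Sstar`:
`E[∑_t (R(Sstar, v_t) - R(S_t, v_t))]`. -/
noncomputable def regretAgainst (π : Policy N K) (𝒜 : Adversary N K g B) (T : ℕ)
    (Sstar : Action N K) : ℝ :=
  ∫ h, ∑ t : Fin T, (meanReward g Sstar (h t).1.1 - meanReward g (h t).1.2 (h t).1.1) ∂(law π 𝒜 T)

/-- The regret over `T` periods: the maximum of the expected regret over the finitely many fixed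
actions. -/
noncomputable def regret (π : Policy N K) (𝒜 : Adversary N K g B) (T : ℕ) : ℝ :=
  ⨆ Sstar : Action N K, regretAgainst π 𝒜 T Sstar

end Interaction

end CombBandit

/-!
The mean reward of an action `S` is `g (∑_{i ∈ S} v i)` with `g` of degree `d`. Since `|S| = K`, the
constant `1` equals `∑_{i ∈ S} 1 / K`, so `g` may be made homogeneous, and the mean reward becomes a
linear function of the tensor power `1_S^{⊗ d}` (`meanReward_mem_tensorSpace`). The game is thus an
adversarial linear bandit in dimension `m ≤ N ^ d` with at most `N ^ K` actions.

The algorithm is exponential weights on the cumulative importance weighted estimates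
`X̂ a = r * k(a, S)`, where `k` is the reproducing kernel, in `L²` of the law of the action, of the
space of linear functions of the features. The reproducing property makes the estimates unbiased
(`sum_repKernel_mul`), and their second moments, averaged over that law, are at most `b² m` when the
feedback is in `[-b, b]`, as the mean of `k` on the diagonal is the dimension `m`
(`sum_repKernel_sq`, `sum_repKernel_diag`). The analysis of exponential weights
(`logWeight_add_le`) also needs `|η X̂| ≤ 1`. To achieve this at a cost of only
`γ = η b N ^ d ≥ η b m` per period, the weights are mixed at rate `γ` with a law that maximizes the
determinant of the design matrix. By the Kiefer–Wolfowitz argument (`exists_design_repKernel_le`)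
the kernel of that law is at most `m` on the diagonal, whence `|k| ≤ m / γ` (`abs_repKernel_le`).

The regret plus a nonnegative logarithmic potential has conditional drift at most `γ + 2 η b² m`
(`integral_law_le`, `regretAgainst_le`), so the regret is at most
`K log N / η + T (γ + 2 η b² m)`. Tuning `η` gives `4 b s` with `b = max 1 B` and
`s = √(N^d T K log N)`. Where `2 s ≥ T`, or where there is only one action, any policy will do.
-/

namespace CombBandit

/-! ### Design matrices and the Kiefer–Wolfowitz theorem -/

section Design

open Matrix

variable {A : Type*} [Fintype A] {m : ℕ}

/-- The second moment matrix `∑ₐ p(a) φ(a) φ(a)ᵀ` of the features `φ` under the weights `p`. -/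
def design (φ : A → Fin m → ℝ) (p : A → ℝ) : Matrix (Fin m) (Fin m) ℝ :=
  ∑ a, p a • vecMulVec (φ a) (φ a)

/-- The reproducing kernel, in `L²(p)`, of the space of functions `a ↦ c ⬝ᵥ φ a`. It is meaningful
only when the design matrix is invertible. -/
noncomputable def repKernel (φ : A → Fin m → ℝ) (p : A → ℝ) (a b : A) : ℝ :=
  ((design φ p)⁻¹ *ᵥ φ a) ⬝ᵥ φ b

lemma design_mulVec (φ : A → Fin m → ℝ) (p : A → ℝ) (c : Fin m → ℝ) :
    design φ p *ᵥ c = ∑ a, (p a * (c ⬝ᵥ φ a)) • φ a := by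
  simp only [design, sum_mulVec, smul_mulVec, vecMulVec_mulVec]
  refine Finset.sum_congr rfl fun a _ => ?_
  ext i
  simp [dotProduct_comm c (φ a)]
  ring

lemma dotProduct_design_mulVec (φ : A → Fin m → ℝ) (p : A → ℝ) (c : Fin m → ℝ) :
    c ⬝ᵥ (design φ p *ᵥ c) = ∑ a, p a * (c ⬝ᵥ φ a) ^ 2 := by
  simp only [design_mulVec, dotProduct_sum, dotProduct_smul, smul_eq_mul]
  exact Finset.sum_congr rfl fun a _ => by ring

lemma design_isHermitian (φ : A → Fin m → ℝ) (p : A → ℝ) : (design φ p).IsHermitian := by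
  ext i j
  simp [design, Matrix.sum_apply, vecMulVec_apply, mul_comm (φ _ i)]

lemma design_posDef {φ : A → Fin m → ℝ} (hφ : ∀ c, (∀ a, c ⬝ᵥ φ a = 0) → c = 0)
    {p : A → ℝ} (hp : ∀ a, 0 < p a) : (design φ p).PosDef := by
  refine PosDef.of_dotProduct_mulVec_pos (design_isHermitian φ p) fun c hc => ?_
  simp only [star_trivial, dotProduct_design_mulVec]
  have hne : ∃ a, c ⬝ᵥ φ a ≠ 0 := by
    by_contra! h
    exact hc (hφ c h)
  obtain ⟨a, ha⟩ := hne
  refine Finset.sum_pos' (fun a _ => by have := (hp a).le; positivity) ⟨a, Finset.mem_univ a, ?_⟩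
  have := hp a
  positivity

/-- The reproducing property. -/
lemma sum_repKernel_mul {φ : A → Fin m → ℝ} {p : A → ℝ} (h : IsUnit (design φ p).det)
    (a : A) (c : Fin m → ℝ) :
    ∑ b, p b * (repKernel φ p a b * (c ⬝ᵥ φ b)) = c ⬝ᵥ φ a := by
  have h1 : ∑ b, p b * (repKernel φ p a b * (c ⬝ᵥ φ b))
      = c ⬝ᵥ (design φ p *ᵥ ((design φ p)⁻¹ *ᵥ φ a)) := by
    rw [design_mulVec]
    simp only [dotProduct_sum, dotProduct_smul, smul_eq_mul, repKernel]
    exact Finset.sum_congr rfl fun b _ => by ring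
  rw [h1, mulVec_mulVec, mul_nonsing_inv _ h, one_mulVec]

lemma sum_repKernel_sq {φ : A → Fin m → ℝ} {p : A → ℝ} (h : IsUnit (design φ p).det) (a : A) :
    ∑ b, p b * repKernel φ p a b ^ 2 = repKernel φ p a a := by
  rw [repKernel, ← sum_repKernel_mul h a ((design φ p)⁻¹ *ᵥ φ a)]
  exact Finset.sum_congr rfl fun b _ => by rw [repKernel]; ring

/-- The dimension of the feature space is the mean of the kernel on the diagonal. -/
lemma sum_repKernel_diag {φ : A → Fin m → ℝ} {p : A → ℝ} (h : IsUnit (design φ p).det) :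
    ∑ a, p a * repKernel φ p a a = m := by
  have h1 : ∀ Q : Matrix (Fin m) (Fin m) ℝ,
      (Q * design φ p).trace = ∑ a, p a * ((Q *ᵥ φ a) ⬝ᵥ φ a) := fun Q => by
    simp [design, Finset.mul_sum, trace_sum, mul_vecMulVec, trace_vecMulVec]
  simp only [repKernel]
  rw [← h1, nonsing_inv_mul _ h, trace_one, Fintype.card_fin]

lemma design_add_single [DecidableEq A] (φ : A → Fin m → ℝ) (p : A → ℝ) (a : A) (δ : ℝ) :
    design φ (p + Pi.single a δ) = design φ p + δ • vecMulVec (φ a) (φ a) := by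
  simp [design, add_smul, Finset.sum_add_distrib, Pi.single_apply, ite_smul]

lemma design_smul (φ : A → Fin m → ℝ) (p : A → ℝ) (δ : ℝ) :
    design φ (δ • p) = δ • design φ p := by
  simp [design, mul_smul, Finset.smul_sum]

lemma det_design_add_single [DecidableEq A] {φ : A → Fin m → ℝ} {p : A → ℝ}
    (h : IsUnit (design φ p).det) (a : A) (δ : ℝ) :
    (design φ (p + Pi.single a δ)).det = (design φ p).det * (1 + δ * repKernel φ p a a) := by
  rw [design_add_single, vecMulVec_eq Unit, ← Matrix.mul_smul, ← replicateRow_smul,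
    det_add_replicateCol_mul_replicateRow h]
  congr 1
  rw [det_unique, Matrix.add_apply, one_apply_eq, Matrix.mul_assoc]
  simp only [repKernel, mul_apply, dotProduct, mulVec, Finset.mul_sum, Finset.sum_mul,
    replicateRow_apply, replicateCol_apply, Pi.smul_apply, smul_eq_mul]
  congr 1
  exact Finset.sum_congr rfl fun _ _ => Finset.sum_congr rfl fun _ _ => by ring

lemma continuous_design (φ : A → Fin m → ℝ) : Continuous (design φ) := by
  unfold design
  fun_prop

/-- **Kiefer–Wolfowitz**: there is a law `μ` on the actions under which the kernel on the
diagonal, whose mean is the dimension `m`, is nowhere larger than `m`. A law maximizing the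
determinant of the design matrix has this property: moving mass towards the action `a` must not
increase the determinant to first order. -/
lemma exists_design_repKernel_le [Nonempty A] {φ : A → Fin m → ℝ}
    (hφ : ∀ c, (∀ a, c ⬝ᵥ φ a = 0) → c = 0) :
    ∃ μ ∈ stdSimplex ℝ A, IsUnit (design φ μ).det ∧ ∀ a, repKernel φ μ a a ≤ m := by
  classical
  obtain ⟨μ, hμ, hmax⟩ := (isCompact_stdSimplex ℝ A).exists_isMaxOn
    ⟨_, single_mem_stdSimplex ℝ (Classical.arbitrary A)⟩
    ((continuous_design φ).matrix_det.continuousOn)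
  have hcard : (0 : ℝ) < Fintype.card A := by exact_mod_cast Fintype.card_pos
  have hpos : 0 < (design φ μ).det := by
    have hu : (fun _ => (Fintype.card A : ℝ)⁻¹ : A → ℝ) ∈ stdSimplex ℝ A :=
      ⟨fun _ => by positivity, by simp [hcard.ne']⟩
    exact (design_posDef hφ fun _ => by positivity).det_pos.trans_le (hmax hu)
  have hunit : IsUnit (design φ μ).det := hpos.ne'.isUnit
  refine ⟨μ, hμ, hunit, fun a => ?_⟩
  set x := repKernel φ μ a a with hx
  have key : ∀ δ : ℝ, 0 < δ → 1 + δ * x ≤ (1 + δ) ^ m := by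
    intro δ hδ
    have h1 : 0 < 1 + δ := by linarith
    have hmem : (1 + δ)⁻¹ • (μ + Pi.single a δ) ∈ stdSimplex ℝ A := by
      refine ⟨fun b => ?_, ?_⟩
      · have := hμ.1 b
        have : 0 ≤ (Pi.single a δ : A → ℝ) b :=
          (Pi.single_nonneg (i := a).2 hδ.le : (0 : A → ℝ) ≤ Pi.single a δ) b
        simp only [Pi.smul_apply, Pi.add_apply, smul_eq_mul]
        positivity
      · simp only [Pi.smul_apply, Pi.add_apply, smul_eq_mul, ← Finset.mul_sum,
          Finset.sum_add_distrib, hμ.2, Finset.sum_pi_single', Finset.mem_univ, if_true]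
        field_simp
    have h2 := hmax hmem
    simp only [Set.mem_ofPred_eq] at h2
    rw [design_smul, det_smul, Fintype.card_fin, det_design_add_single hunit, inv_pow,
      inv_mul_le_iff₀ (by positivity)] at h2
    rw [mul_comm] at h2
    exact le_of_mul_le_mul_right h2 hpos
  have hder : HasDerivAt (fun δ : ℝ => (1 + δ) ^ m) m 0 := by
    have := ((hasDerivAt_id (0 : ℝ)).const_add 1).pow m
    simpa [Pi.pow_def] using this
  have hlim := hder.tendsto_slope_zero_right
  refine ge_of_tendsto hlim ?_
  filter_upwards [self_mem_nhdsWithin] with δ hδ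
  have hδ : 0 < δ := hδ
  simp only [zero_add, add_zero, one_pow, smul_eq_mul]
  rw [inv_mul_eq_div, le_div_iff₀ hδ]
  linarith [key δ hδ]

/-- With exploration by a Kiefer–Wolfowitz law at rate `γ`, the kernel is bounded by `m / γ`. -/
lemma abs_repKernel_le {φ : A → Fin m → ℝ} {μ p : A → ℝ} {γ : ℝ} (hγ : 0 < γ)
    (hμ : ∀ a, 0 ≤ μ a) (hμdet : IsUnit (design φ μ).det) (hμle : ∀ a, repKernel φ μ a a ≤ m)
    (hp : ∀ a, γ * μ a ≤ p a) (hpdet : IsUnit (design φ p).det) (a b : A) :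
    |repKernel φ p a b| ≤ m / γ := by
  have hm : (0 : ℝ) ≤ m / γ := by positivity
  -- every function in the feature space is bounded by its norm in `L²(p)`
  have hsup : ∀ (c : Fin m → ℝ) (a : A),
      (c ⬝ᵥ φ a) ^ 2 ≤ m / γ * ∑ b, p b * (c ⬝ᵥ φ b) ^ 2 := by
    intro c a
    have hcs := Finset.sum_mul_sq_le_sq_mul_sq Finset.univ
      (fun b => √(μ b) * repKernel φ μ a b) (fun b => √(μ b) * (c ⬝ᵥ φ b))
    have e1 : ∑ b, √(μ b) * repKernel φ μ a b * (√(μ b) * (c ⬝ᵥ φ b)) = c ⬝ᵥ φ a := by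
      rw [← sum_repKernel_mul hμdet a c]
      refine Finset.sum_congr rfl fun b _ => ?_
      calc _ = (√(μ b) * √(μ b)) * (repKernel φ μ a b * (c ⬝ᵥ φ b)) := by ring
        _ = _ := by rw [Real.mul_self_sqrt (hμ b)]
    simp only [e1, mul_pow, Real.sq_sqrt (hμ _), sum_repKernel_sq hμdet a] at hcs
    calc (c ⬝ᵥ φ a) ^ 2 ≤ repKernel φ μ a a * ∑ b, μ b * (c ⬝ᵥ φ b) ^ 2 := hcs
      _ ≤ m * ∑ b, (γ⁻¹ * p b) * (c ⬝ᵥ φ b) ^ 2 := by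
        refine mul_le_mul (hμle a) (Finset.sum_le_sum fun b _ => ?_)
          (Finset.sum_nonneg fun b _ => mul_nonneg (hμ b) (sq_nonneg _)) (Nat.cast_nonneg m)
        refine mul_le_mul_of_nonneg_right ?_ (sq_nonneg _)
        rw [inv_mul_eq_div, le_div_iff₀ hγ, mul_comm]
        exact hp b
      _ = _ := by simp only [mul_assoc, ← Finset.mul_sum]; ring
  have hker : ∀ a b, repKernel φ p a b ^ 2 ≤ m / γ * repKernel φ p a a := fun a b => by
    rw [← sum_repKernel_sq hpdet a]
    exact hsup _ b
  have hdiag : repKernel φ p a a ≤ m / γ := by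
    by_contra! h
    nlinarith [hker a a]
  refine abs_le_of_sq_le_sq ((hker a b).trans ?_) hm
  nlinarith

lemma measurable_repKernel {X : Type*} [MeasurableSpace X] (φ : A → Fin m → ℝ) {p : X → A → ℝ}
    (hp : Measurable p) (a b : A) : Measurable fun x => repKernel φ (p x) a b := by
  have h1 : Measurable fun x => (design φ (p x)).det :=
    ((continuous_design φ).matrix_det.measurable).comp hp
  have h2 : ∀ i j, Measurable fun x => (design φ (p x)).adjugate i j := fun i j =>
    (((continuous_design φ).matrix_adjugate.matrix_elem i j).measurable).comp hp
  have h3 : ∀ i j, Measurable fun x => (design φ (p x))⁻¹ i j := fun i j => by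
    simp only [inv_def, Ring.inverse_eq_inv', Matrix.smul_apply, smul_eq_mul]
    exact h1.inv.mul (h2 i j)
  simp only [repKernel, dotProduct, mulVec]
  exact Finset.measurable_fun_sum _ fun j _ => (Finset.measurable_fun_sum _ fun i _ =>
    (h3 j i).mul_const _).mul_const _

end Design

/-! ### Exponential weights -/

section Softmax

variable {A : Type*} [Fintype A]

/-- The law on the actions proportional to `exp (η w)`. -/
noncomputable def softmax (η : ℝ) (w : A → ℝ) (a : A) : ℝ :=
  Real.exp (η * w a) / ∑ b, Real.exp (η * w b)

/-- The logarithm of the sum of the weights. -/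
noncomputable def logWeight (η : ℝ) (w : A → ℝ) : ℝ :=
  Real.log (∑ b, Real.exp (η * w b))

lemma measurable_softmax {X : Type*} [MeasurableSpace X] (η : ℝ) {w : X → A → ℝ}
    (hw : Measurable w) : Measurable fun x => softmax η (w x) := by
  refine measurable_pi_lambda _ fun a => ?_
  have h : ∀ a, Measurable fun x => w x a := fun a => (measurable_pi_apply a).comp hw
  unfold softmax
  fun_prop

lemma measurable_logWeight {X : Type*} [MeasurableSpace X] (η : ℝ) {w : X → A → ℝ}
    (hw : Measurable w) : Measurable fun x => logWeight η (w x) := by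
  have h : ∀ a, Measurable fun x => w x a := fun a => (measurable_pi_apply a).comp hw
  unfold logWeight
  fun_prop

variable [Nonempty A]

lemma sum_exp_pos (η : ℝ) (w : A → ℝ) : 0 < ∑ b, Real.exp (η * w b) :=
  Finset.sum_pos (fun _ _ => Real.exp_pos _) Finset.univ_nonempty

lemma softmax_pos (η : ℝ) (w : A → ℝ) (a : A) : 0 < softmax η w a :=
  div_pos (Real.exp_pos _) (sum_exp_pos η w)

lemma sum_softmax (η : ℝ) (w : A → ℝ) : ∑ a, softmax η w a = 1 := by
  simp only [softmax, ← Finset.sum_div]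
  exact div_self (sum_exp_pos η w).ne'

lemma le_logWeight (η : ℝ) (w : A → ℝ) (a : A) : η * w a ≤ logWeight η w := by
  rw [logWeight, Real.le_log_iff_exp_le (sum_exp_pos η w)]
  exact Finset.single_le_sum (f := fun b => Real.exp (η * w b))
    (fun _ _ => (Real.exp_pos _).le) (Finset.mem_univ a)

lemma logWeight_le {η C : ℝ} {w : A → ℝ} (h : ∀ a, η * w a ≤ C) :
    logWeight η w ≤ Real.log (Fintype.card A) + C := by
  have hcard : (0 : ℝ) < Fintype.card A := by exact_mod_cast Fintype.card_pos
  rw [logWeight, Real.log_le_iff_le_exp (sum_exp_pos η w), Real.exp_add, Real.exp_log hcard]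
  calc ∑ b, Real.exp (η * w b) ≤ ∑ _b : A, Real.exp C :=
        Finset.sum_le_sum fun b _ => Real.exp_le_exp.2 (h b)
    _ = _ := by simp

/-- One step of the exponential weights analysis. -/
lemma logWeight_add_le {η : ℝ} (w x : A → ℝ) (hx : ∀ a, |η * x a| ≤ 1) :
    logWeight η (w + x) ≤ logWeight η w + η * ∑ a, softmax η w a * x a
      + η ^ 2 * ∑ a, softmax η w a * x a ^ 2 := by
  have hZ := sum_exp_pos η w
  have hsplit : ∑ b, Real.exp (η * (w + x) b)
      = (∑ b, Real.exp (η * w b)) * ∑ a, softmax η w a * Real.exp (η * x a) := by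
    rw [Finset.mul_sum]
    refine Finset.sum_congr rfl fun a _ => ?_
    rw [softmax, Pi.add_apply, mul_add, Real.exp_add]
    field_simp
  have hpos : 0 < ∑ a, softmax η w a * Real.exp (η * x a) :=
    Finset.sum_pos (fun a _ => mul_pos (softmax_pos η w a) (Real.exp_pos _)) Finset.univ_nonempty
  have hexp : ∑ a, softmax η w a * Real.exp (η * x a)
      ≤ ∑ a, (softmax η w a + η * (softmax η w a * x a) + η ^ 2 * (softmax η w a * x a ^ 2)) := by
    refine Finset.sum_le_sum fun a _ => ?_
    have h1 := (abs_le.1 (Real.abs_exp_sub_one_sub_id_le (hx a))).2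
    nlinarith [softmax_pos η w a]
  simp only [Finset.sum_add_distrib, sum_softmax, ← Finset.mul_sum] at hexp
  have hlog := Real.log_le_sub_one_of_pos hpos
  rw [logWeight, hsplit, Real.log_mul hZ.ne' hpos.ne']
  unfold logWeight
  linarith

end Softmax

/-! ### Polynomial rewards as linear functions of features -/

section Features

variable {N K : ℕ}

/-- The span of the functions `S ↦ ∏ⱼ 1[xⱼ ∈ S]` on the actions, over all `x ∈ [N]^d`: the linear
functions of the tensor power `1_S^{⊗ d}`. -/
noncomputable def tensorSpace (N K d : ℕ) : Submodule ℝ (Action N K → ℝ) :=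
  Submodule.span ℝ (Set.range fun (x : Fin d → Fin N) (S : Action N K) =>
    ∏ j, if x j ∈ S.1 then (1 : ℝ) else 0)

lemma finrank_tensorSpace_le (N K d : ℕ) : Module.finrank ℝ (tensorSpace N K d) ≤ N ^ d :=
  (finrank_range_le_card (R := ℝ) _).trans_eq (by simp)

lemma prod_sum_mem_tensorSpace {d : ℕ} (u : Fin d → Fin N → ℝ) :
    (fun S : Action N K => ∏ j, ∑ i ∈ S.1, u j i) ∈ tensorSpace N K d := by
  have h : (fun S : Action N K => ∏ j, ∑ i ∈ S.1, u j i)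
      = ∑ x : Fin d → Fin N, (∏ j, u j (x j)) •
        fun S : Action N K => ∏ j, if x j ∈ S.1 then (1 : ℝ) else 0 := by
    ext S
    have h1 : ∀ j, ∑ i ∈ S.1, u j i = ∑ i, u j i * if i ∈ S.1 then (1 : ℝ) else 0 := fun j => by
      simp
    simp only [h1, Finset.prod_univ_sum, Fintype.piFinset_univ, Finset.sum_apply, Pi.smul_apply,
      smul_eq_mul, Finset.prod_mul_distrib]
  rw [h]
  exact Submodule.sum_mem _ fun x _ =>
    Submodule.smul_mem _ _ (Submodule.subset_span (Set.mem_range_self x))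

/-- The monomials of degree below `d` are made homogeneous of degree `d` with the help of
`∑_{i ∈ S} 1 / K = 1`. -/
lemma meanReward_mem_tensorSpace (hK : K ≠ 0) (g : ℝ[X]) (v : RewardVec N) :
    (fun S : Action N K => meanReward g S v) ∈ tensorSpace N K g.natDegree := by
  have h : (fun S : Action N K => meanReward g S v) = ∑ k ∈ Finset.range (g.natDegree + 1),
      g.coeff k • fun S : Action N K => (∑ i ∈ S.1, (v i : ℝ)) ^ k := by
    ext S
    simp [meanReward, Polynomial.eval_eq_sum_range]
  rw [h]
  refine Submodule.sum_mem _ fun k hk => Submodule.smul_mem _ _ ?_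
  have hk' : k ≤ g.natDegree := Nat.lt_succ_iff.1 (Finset.mem_range.1 hk)
  convert prod_sum_mem_tensorSpace (K := K) (d := g.natDegree)
    (fun j i => if (j : ℕ) < k then (v i : ℝ) else (K : ℝ)⁻¹) using 2 with S
  have h1 : ∀ j : Fin g.natDegree,
      ∑ i ∈ S.1, (if (j : ℕ) < k then (v i : ℝ) else (K : ℝ)⁻¹)
        = if (j : ℕ) < k then ∑ i ∈ S.1, (v i : ℝ) else 1 := fun j => by
    split_ifs
    · rfl
    · rw [Finset.sum_const, S.2, nsmul_eq_mul, mul_inv_cancel₀ (Nat.cast_ne_zero.2 hK)]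
  simp only [h1, Finset.prod_ite, Finset.prod_const, one_pow, mul_one]
  congr 1
  rw [Fin.card_filter_val_lt, min_eq_right hk']

/-- Coordinates: the mean rewards are linear functions of a feature vector of dimension at most
`N ^ d`, whose coordinates are linearly independent. -/
lemma exists_features (hK : K ≠ 0) (g : ℝ[X]) :
    ∃ m : ℕ, m ≤ N ^ g.natDegree ∧ ∃ φ : Action N K → Fin m → ℝ,
      (∀ c, (∀ S, c ⬝ᵥ φ S = 0) → c = 0) ∧
      ∀ v : RewardVec N, ∃ c, ∀ S, meanReward g S v = c ⬝ᵥ φ S := by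
  set V := tensorSpace N K g.natDegree
  let β := Module.finBasis ℝ V
  have hdot : ∀ (c : Fin (Module.finrank ℝ V) → ℝ) (S : Action N K),
      c ⬝ᵥ (fun i => (β i : Action N K → ℝ) S)
        = ((∑ i, c i • β i : V) : Action N K → ℝ) S := fun c S => by
    simp [dotProduct]
  refine ⟨Module.finrank ℝ V, finrank_tensorSpace_le N K _,
    fun S i => (β i : Action N K → ℝ) S, fun c hc => ?_, fun v => ?_⟩
  · have h0 : ∑ i, c i • β i = 0 := by
      ext S
      rw [← hdot, hc S]
      rfl
    funext i
    exact Fintype.linearIndependent_iff.1 β.linearIndependent c h0 i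
  · refine ⟨β.repr ⟨_, meanReward_mem_tensorSpace hK g v⟩, fun S => ?_⟩
    rw [hdot, β.sum_repr]

/-- There are at most `N ^ K` actions. -/
lemma log_card_action_le (N K : ℕ) :
    Real.log (Fintype.card (Action N K)) ≤ K * Real.log N := by
  have h1 : Fintype.card (Action N K) ≤ N ^ K := by
    rw [Fintype.card_finset_len, Fintype.card_fin]
    exact Nat.choose_le_pow N K
  rcases Nat.eq_zero_or_pos (Fintype.card (Action N K)) with h0 | h0
  · rw [h0, Nat.cast_zero, Real.log_zero]
    exact mul_nonneg K.cast_nonneg (Real.log_natCast_nonneg N)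
  · rw [← Real.log_pow]
    exact Real.log_le_log (by exact_mod_cast h0) (by exact_mod_cast h1)

end Features

/-! ### The sampling law and the reward estimates -/

section Step

variable {A : Type*} [Fintype A] {m : ℕ}

/-- The law of the action: exponential weights, mixed with the exploration law `μ` at rate `γ`. -/
noncomputable def sampling (μ : A → ℝ) (η γ : ℝ) (w : A → ℝ) (a : A) : ℝ :=
  (1 - γ) * softmax η w a + γ * μ a

/-- The feedback truncated to `[-b, b]`. The feedback is bounded only almost surely; truncation
makes the estimates bounded on every record. -/
noncomputable def clip (b r : ℝ) : ℝ := max (-b) (min r b)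

lemma abs_clip_le {b : ℝ} (hb : 0 ≤ b) (r : ℝ) : |clip b r| ≤ b :=
  abs_le.2 ⟨le_max_left _ _, max_le (by linarith) (min_le_right _ _)⟩

lemma clip_eq_self {b r : ℝ} (h : r ∈ Set.Icc (-b) b) : clip b r = r := by
  rw [clip, min_eq_left h.2, max_eq_right h.1]

lemma measurable_clip (b : ℝ) : Measurable (clip b) := by
  unfold clip
  fun_prop

/-- The importance weighted estimate of the reward of each action `a`, from the feedback `r` to
an action `S` drawn from the law `p`. -/
noncomputable def estimate (φ : A → Fin m → ℝ) (b : ℝ) (p : A → ℝ) (S : A) (r : ℝ) (a : A) : ℝ :=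
  clip b r * repKernel φ p a S

variable [Nonempty A] {φ : A → Fin m → ℝ} {μ : A → ℝ} {η γ b : ℝ}

lemma sampling_pos (hμ : μ ∈ stdSimplex ℝ A) (hγ : 0 ≤ γ) (hγ1 : γ < 1) (w : A → ℝ) (a : A) :
    0 < sampling μ η γ w a := by
  have h1 := softmax_pos η w a
  have h2 := hμ.1 a
  have h3 : 0 < 1 - γ := by linarith
  unfold sampling
  positivity

lemma sum_sampling (hμ : μ ∈ stdSimplex ℝ A) (w : A → ℝ) : ∑ a, sampling μ η γ w a = 1 := by
  simp only [sampling, Finset.sum_add_distrib, ← Finset.mul_sum, sum_softmax, hμ.2]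
  ring

lemma isUnit_det_design_sampling (hφ : ∀ c, (∀ a, c ⬝ᵥ φ a = 0) → c = 0)
    (hμ : μ ∈ stdSimplex ℝ A) (hγ : 0 ≤ γ) (hγ1 : γ < 1) (w : A → ℝ) :
    IsUnit (design φ (sampling μ η γ w)).det :=
  (design_posDef hφ (sampling_pos hμ hγ hγ1 w)).det_pos.ne'.isUnit

lemma abs_repKernel_sampling_le (hφ : ∀ c, (∀ a, c ⬝ᵥ φ a = 0) → c = 0)
    (hμ : μ ∈ stdSimplex ℝ A) (hμdet : IsUnit (design φ μ).det)
    (hμle : ∀ a, repKernel φ μ a a ≤ m) (hγ : 0 < γ) (hγ1 : γ < 1) (w : A → ℝ) (a a' : A) :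
    |repKernel φ (sampling μ η γ w) a a'| ≤ m / γ := by
  refine abs_repKernel_le hγ hμ.1 hμdet hμle (fun a => ?_)
    (isUnit_det_design_sampling hφ hμ hγ.le hγ1 w) a a'
  have := mul_nonneg (sub_nonneg.2 hγ1.le) (softmax_pos η w a).le
  unfold sampling
  linarith

/-- The mean over the drawn action `S` of the one-step bound, once the feedback has been replaced
by its mean `f S` and its square by the bound `b ^ 2`: the estimates are unbiased, exploration
costs at most `γ`, and the second moments add up to the dimension. -/
lemma sum_sampling_mul_le (hφ : ∀ c, (∀ a, c ⬝ᵥ φ a = 0) → c = 0)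
    (hμ : μ ∈ stdSimplex ℝ A) (hγ : 0 ≤ γ) (hγ1 : γ ≤ 1 / 2) (hη : 0 ≤ η) (w : A → ℝ)
    {f : A → ℝ} (hf : ∃ c, ∀ a, f a = c ⬝ᵥ φ a) (hf0 : ∀ a, 0 ≤ f a) (hf1 : ∀ a, f a ≤ 1)
    (a₀ : A) :
    ∑ S, sampling μ η γ w S * (f a₀ - f S +
      f S * (∑ a, softmax η w a * repKernel φ (sampling μ η γ w) a S
        - repKernel φ (sampling μ η γ w) a₀ S) +
      b ^ 2 * (η * ∑ a, softmax η w a * repKernel φ (sampling μ η γ w) a S ^ 2))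
      ≤ γ + 2 * η * b ^ 2 * m := by
  set p := sampling μ η γ w with hp
  set q := softmax η w
  obtain ⟨c, hc⟩ := hf
  have hunit : IsUnit (design φ p).det :=
    isUnit_det_design_sampling hφ hμ hγ (by linarith) w
  have hrep : ∀ a, ∑ S, p S * (repKernel φ p a S * f S) = f a := fun a => by
    simp only [hc]
    exact sum_repKernel_mul hunit a c
  have hp1 : ∑ S, p S = 1 := sum_sampling hμ w
  have hpf : ∑ S, p S * f S = (1 - γ) * ∑ a, q a * f a + γ * ∑ a, μ a * f a := by
    simp only [hp, sampling, Finset.mul_sum, ← Finset.sum_add_distrib]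
    exact Finset.sum_congr rfl fun a _ => by ring
  have hqf : ∑ a, q a * f a ≤ 1 := by
    rw [← sum_softmax η w]
    exact Finset.sum_le_sum fun a _ =>
      mul_le_of_le_one_right (softmax_pos η w a).le (hf1 a)
  have hμf : 0 ≤ ∑ a, μ a * f a :=
    Finset.sum_nonneg fun a _ => mul_nonneg (hμ.1 a) (hf0 a)
  have hq : ∀ a, q a ≤ 2 * p a := fun a => by
    have h1 := softmax_pos η w a
    have h2 := mul_nonneg hγ (hμ.1 a)
    have h3 : p a = (1 - γ) * softmax η w a + γ * μ a := rfl
    change softmax η w a ≤ 2 * p a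
    nlinarith
  have hcross : ∑ S, p S * (f S * ∑ a, q a * repKernel φ p a S) = ∑ a, q a * f a := by
    rw [show ∑ a, q a * f a = ∑ a, q a * ∑ S, p S * (repKernel φ p a S * f S) from
      Finset.sum_congr rfl fun a _ => by rw [hrep a]]
    simp only [Finset.mul_sum]
    rw [Finset.sum_comm]
    exact Finset.sum_congr rfl fun a _ => Finset.sum_congr rfl fun S _ => by ring
  have hcross₀ : ∑ S, p S * (f S * repKernel φ p a₀ S) = f a₀ := by
    rw [← hrep a₀]
    exact Finset.sum_congr rfl fun S _ => by ring
  have hsq : ∑ S, p S * ∑ a, q a * repKernel φ p a S ^ 2 ≤ 2 * m := by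
    calc ∑ S, p S * ∑ a, q a * repKernel φ p a S ^ 2
        = ∑ a, q a * ∑ S, p S * repKernel φ p a S ^ 2 := by
          simp only [Finset.mul_sum]
          rw [Finset.sum_comm]
          exact Finset.sum_congr rfl fun a _ => Finset.sum_congr rfl fun S _ => by ring
      _ ≤ ∑ a, 2 * p a * ∑ S, p S * repKernel φ p a S ^ 2 := by
          refine Finset.sum_le_sum fun a _ => mul_le_mul_of_nonneg_right (hq a) ?_
          exact Finset.sum_nonneg fun S _ =>
            mul_nonneg (sampling_pos hμ hγ (by linarith) w S).le (sq_nonneg _)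
      _ = 2 * m := by
          simp only [sum_repKernel_sq hunit, mul_assoc, ← Finset.mul_sum, sum_repKernel_diag hunit]
  have hexpand : ∑ S, p S * (f a₀ - f S +
      f S * (∑ a, q a * repKernel φ p a S - repKernel φ p a₀ S) +
      b ^ 2 * (η * ∑ a, q a * repKernel φ p a S ^ 2))
      = f a₀ * ∑ S, p S - ∑ S, p S * f S
        + (∑ S, p S * (f S * ∑ a, q a * repKernel φ p a S)
          - ∑ S, p S * (f S * repKernel φ p a₀ S))
        + b ^ 2 * η * ∑ S, p S * ∑ a, q a * repKernel φ p a S ^ 2 := by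
    rw [Finset.mul_sum, Finset.mul_sum (a := b ^ 2 * η), ← Finset.sum_sub_distrib,
      ← Finset.sum_sub_distrib, ← Finset.sum_add_distrib, ← Finset.sum_add_distrib]
    exact Finset.sum_congr rfl fun S _ => by ring
  rw [hexpand, hp1, hcross, hcross₀, hpf]
  have h4 := mul_le_mul_of_nonneg_left hsq (by positivity : 0 ≤ b ^ 2 * η)
  nlinarith

end Step

/-! ### Measurability of the estimates -/

section Measurability

variable {A : Type*} [Fintype A] {m : ℕ} {X : Type*} [MeasurableSpace X]

lemma measurable_sampling (μ : A → ℝ) (η γ : ℝ) {w : X → A → ℝ} (hw : Measurable w) :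
    Measurable fun x => sampling μ η γ (w x) := by
  refine measurable_pi_lambda _ fun a => ?_
  have h : Measurable fun x => softmax η (w x) a :=
    (measurable_pi_apply a).comp (measurable_softmax η hw)
  unfold sampling
  fun_prop

lemma measurable_estimate [MeasurableSpace A] [DiscreteMeasurableSpace A]
    (φ : A → Fin m → ℝ) (b : ℝ) {p : X → A → ℝ} (hp : Measurable p)
    {S : X → A} (hS : Measurable S) {r : X → ℝ} (hr : Measurable r) :
    Measurable fun x => estimate φ b (p x) (S x) (r x) := by
  refine measurable_pi_lambda _ fun a => ?_
  have h : Measurable fun y : (A → ℝ) × A => repKernel φ y.1 a y.2 :=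
    measurable_from_prod_countable_left fun S => measurable_repKernel φ measurable_id a S
  have h1 : Measurable fun x => clip b (r x) := (measurable_clip b).comp hr
  have h2 : Measurable fun x => repKernel φ (p x) a (S x) :=
    Measurable.comp (g := fun y : (A → ℝ) × A => repKernel φ y.1 a y.2)
      (f := fun x => (p x, S x)) h (hp.prodMk hS)
  exact h1.mul h2

lemma measurable_meanReward {N K : ℕ} (g : ℝ[X]) :
    Measurable fun x : Action N K × RewardVec N => meanReward g x.1 x.2 := by
  refine measurable_from_prod_countable_right fun S => ?_
  have : Continuous fun v : RewardVec N => meanReward g S v := by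
    unfold meanReward
    fun_prop
  exact this.measurable

end Measurability

/-! ### Integration along the game -/

section Integrals

variable {N K : ℕ} {g : ℝ[X]} {B : ℝ}

/-- An algorithm may use any action probabilities that depend measurably on the observations. -/
lemma exists_policy (p : ∀ t, Observation N K t → Action N K → ℝ) (hp : ∀ t, Measurable (p t))
    (hp0 : ∀ t o S, 0 ≤ p t o S) (hp1 : ∀ t o, ∑ S, p t o S = 1) :
    ∃ π : Policy N K, ∀ t o (f : Action N K → ℝ),
      ∫ S, f S ∂(π.action t o) = ∑ S, p t o S * f S := by
  let κ : ∀ t, Kernel (Observation N K t) (Action N K) := fun t =>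
    { toFun := fun o => ∑ S, ENNReal.ofReal (p t o S) • Measure.dirac S
      measurable' := by
        refine Measure.measurable_of_measurable_coe _ fun s hs => ?_
        simp only [Measure.coe_finsetSum, Finset.sum_apply, Measure.smul_apply, smul_eq_mul]
        refine Finset.measurable_fun_sum _ fun S _ => Measurable.mul_const ?_ _
        exact ((measurable_pi_apply S).comp (hp t)).ennreal_ofReal }
  have hκ : ∀ t o, κ t o = ∑ S, ENNReal.ofReal (p t o S) • Measure.dirac S := fun _ _ => rfl
  refine ⟨⟨κ, fun t => ⟨fun o => ⟨?_⟩⟩⟩, fun t o f => ?_⟩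
  · simp [hκ, ← ENNReal.ofReal_sum_of_nonneg fun S _ => hp0 t o S, hp1]
  · simp only [hκ]
    rw [integral_finsetSum_measure fun S _ =>
      (integrable_dirac (by simp)).smul_measure ENNReal.ofReal_ne_top]
    simp [integral_smul_measure, hp0]

lemma integrable_of_abs_le {X : Type*} [MeasurableSpace X] {ν : Measure X} [IsFiniteMeasure ν]
    {f : X → ℝ} (hf : Measurable f) {C : ℝ} (h : ∀ x, |f x| ≤ C) : Integrable f ν :=
  Integrable.of_bound hf.aestronglyMeasurable C (ae_of_all _ h)

lemma integral_nextRound (π : Policy N K) (𝒜 : Adversary N K g B) (t : ℕ) (h : History N K t)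
    {f : Round N K → ℝ} (hf : Measurable f) {C : ℝ} (hC : ∀ x, |f x| ≤ C) :
    ∫ x, f x ∂(nextRound π 𝒜 t h) =
      ∫ v, ∫ S, ∫ r, f ((v, S), r) ∂(𝒜.feedback t (h, (v, S))) ∂(π.action t (observe h))
        ∂(𝒜.reward t h) := by
  rw [nextRound, ProbabilityTheory.integral_compProd (integrable_of_abs_le hf hC),
    Kernel.prod_apply, Kernel.comap_apply, integral_prod]
  refine Integrable.of_bound ?_ C (ae_of_all _ fun y => ?_)
  · have h1 : Measurable fun z : (RewardVec N × Action N K) × ℝ => f z := hf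
    have h2 : StronglyMeasurable fun y : RewardVec N × Action N K =>
        ∫ r, f (y, r) ∂((𝒜.feedback t).comap (Prod.mk h) measurable_prodMk_left y) :=
      StronglyMeasurable.integral_kernel_prod_right h1.stronglyMeasurable
    exact h2.aestronglyMeasurable
  · refine (norm_integral_le_of_norm_le_const (ae_of_all _ fun r => hC (y, r))).trans_eq ?_
    simp

/-- A function of the record whose conditional mean increases by at most `β` in each period has
mean at most its initial value plus `T * β`. -/
lemma integral_law_le (π : Policy N K) (𝒜 : Adversary N K g B) (Z : ∀ t, History N K t → ℝ)
    (hm : ∀ t, Measurable (Z t)) (C : ℕ → ℝ) (hC : ∀ t h, |Z t h| ≤ C t) (β : ℝ)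
    (hstep : ∀ t h, ∫ x, (Z (t + 1) (append (h, x)) - Z t h) ∂(nextRound π 𝒜 t h) ≤ β) (T : ℕ) :
    ∫ h, Z T h ∂(law π 𝒜 T) ≤ Z 0 Fin.elim0 + T * β := by
  induction T with
  | zero => simp [law, integral_dirac' _ _ (hm 0).stronglyMeasurable]
  | succ t ih =>
    have hmeas : Measurable fun y : History N K t × Round N K => Z (t + 1) (append y) :=
      (hm (t + 1)).comp measurable_append
    have hint : Integrable (fun y => Z (t + 1) (append y)) (law π 𝒜 t ⊗ₘ nextRound π 𝒜 t) :=
      integrable_of_abs_le hmeas fun y => hC (t + 1) _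
    rw [law, integral_map measurable_append.aemeasurable (hm (t + 1)).aestronglyMeasurable,
      Measure.integral_compProd hint]
    have hZ : Integrable (Z t) (law π 𝒜 t) := integrable_of_abs_le (hm t) (hC t)
    calc ∫ h, ∫ x, Z (t + 1) (append (h, x)) ∂(nextRound π 𝒜 t h) ∂(law π 𝒜 t)
        ≤ ∫ h, (Z t h + β) ∂(law π 𝒜 t) :=
by
          refine integral_mono (Integrable.integral_compProd hint)
            (hZ.add (integrable_const β)) fun h => ?_
          have h1 : Integrable (fun x => Z (t + 1) (append (h, x))) (nextRound π 𝒜 t h) :=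
            integrable_of_abs_le (hmeas.comp measurable_prodMk_left) fun x => hC (t + 1) _
          have h2 := hstep t h
          rw [integral_sub h1 (integrable_const _)] at h2
          simp only [integral_const, probReal_univ, one_smul] at h2
          linarith
      _ = ∫ h, Z t h ∂(law π 𝒜 t) + β := by
          rw [integral_add hZ (integrable_const β)]
          simp
      _ ≤ Z 0 Fin.elim0 + ((t + 1 : ℕ) : ℝ) * β := by
          push_cast
          linarith

lemma meanReward_mem_Icc (hg : ∀ x ∈ Set.Icc (0 : ℝ) K, g.eval x ∈ Set.Icc (0 : ℝ) 1)
    (S : Action N K) (v : RewardVec N) : meanReward g S v ∈ Set.Icc (0 : ℝ) 1 := by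
  refine hg _ ⟨Finset.sum_nonneg fun i _ => (v i).2.1, ?_⟩
  calc ∑ i ∈ S.1, (v i : ℝ) ≤ ∑ i ∈ S.1, (1 : ℝ) := Finset.sum_le_sum fun i _ => (v i).2.2
    _ = K := by simp [S.2]

lemma abs_meanReward_sub_le (hg : ∀ x ∈ Set.Icc (0 : ℝ) K, g.eval x ∈ Set.Icc (0 : ℝ) 1)
    (S S' : Action N K) (v : RewardVec N) : |meanReward g S v - meanReward g S' v| ≤ 1 := by
  have h1 := meanReward_mem_Icc hg S v
  have h2 := meanReward_mem_Icc hg S' v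
  rw [abs_le]
  constructor <;> linarith [h1.1, h1.2, h2.1, h2.2]

/-- No integrability is needed, since the integral of a non-integrable function is `0`. -/
lemma integral_le_of_forall_le {X : Type*} [MeasurableSpace X] {ν : Measure X}
    [IsProbabilityMeasure ν] {f : X → ℝ} {c : ℝ} (hc : 0 ≤ c) (h : ∀ x, f x ≤ c) :
    ∫ x, f x ∂ν ≤ c := by
  by_cases hf : Integrable f ν
  · simpa using integral_mono hf (integrable_const c) h
  · rwa [integral_undef hf]

/-- Bound on the conditional mean of a function of the next period that is at most quadratic in the
truncated feedback: the feedback may be replaced by its mean and its square by `b ^ 2`. -/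
lemma integral_nextRound_le (π : Policy N K) (𝒜 : Adversary N K g B) (t : ℕ) (h : History N K t)
    {p : Action N K → ℝ} (hp0 : ∀ S, 0 ≤ p S)
    (hπ : ∀ f : Action N K → ℝ, ∫ S, f S ∂(π.action t (observe h)) = ∑ S, p S * f S)
    {F : Round N K → ℝ} (hF : Measurable F) {C : ℝ} (hC : ∀ x, |F x| ≤ C)
    {b : ℝ} (hb : 0 ≤ b) (hBb : B ≤ b) {α : RewardVec N → Action N K → ℝ}
    {β κ : Action N K → ℝ} (hκ : ∀ S, 0 ≤ κ S)
    (hle : ∀ v S r, F ((v, S), r) ≤ α v S + clip b r * β S + clip b r ^ 2 * κ S)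
    {c : ℝ} (hc : 0 ≤ c)
    (hsum : ∀ v, ∑ S, p S * (α v S + meanReward g S v * β S + b ^ 2 * κ S) ≤ c) :
    ∫ x, F x ∂(nextRound π 𝒜 t h) ≤ c := by
  rw [integral_nextRound π 𝒜 t h hF hC]
  refine integral_le_of_forall_le hc fun v => ?_
  rw [hπ]
  refine le_trans (Finset.sum_le_sum fun S _ => mul_le_mul_of_nonneg_left ?_ (hp0 S)) (hsum v)
  set ν := 𝒜.feedback t (h, (v, S)) with hν
  have hclip : Integrable (fun r => clip b r) ν :=
    integrable_of_abs_le (measurable_clip b) fun r => abs_clip_le hb r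
  have hsq_le : ∀ r, clip b r ^ 2 ≤ b ^ 2 := fun r =>
    sq_le_sq' (abs_le.1 (abs_clip_le hb r)).1 (abs_le.1 (abs_clip_le hb r)).2
  have hclip2 : Integrable (fun r => clip b r ^ 2) ν :=
    integrable_of_abs_le ((measurable_clip b).pow_const 2) fun r => by
      rw [abs_of_nonneg (sq_nonneg _)]
      exact hsq_le r
  have hmean : ∫ r, clip b r ∂ν = meanReward g S v := by
    rw [← 𝒜.feedback_mean t h v S]
    refine integral_congr_ae ?_
    filter_upwards [𝒜.feedback_bounded t h v S] with r hr
    exact clip_eq_self ⟨by linarith [hr.1], hr.2.trans hBb⟩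
  have hsq : ∫ r, clip b r ^ 2 ∂ν ≤ b ^ 2 := integral_le_of_forall_le (sq_nonneg b) hsq_le
  have hlin : Integrable (fun r => α v S + clip b r * β S) ν :=
    (integrable_const _).add (hclip.mul_const _)
  calc ∫ r, F ((v, S), r) ∂ν
      ≤ ∫ r, (α v S + clip b r * β S + clip b r ^ 2 * κ S) ∂ν :=
        integral_mono (integrable_of_abs_le (hF.comp measurable_prodMk_left) fun r => hC _)
          (hlin.add (hclip2.mul_const _)) (hle v S)
    _ = α v S + meanReward g S v * β S + (∫ r, clip b r ^ 2 ∂ν) * κ S := by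
        rw [integral_add hlin (hclip2.mul_const _),
          integral_add (integrable_const _) (hclip.mul_const _), integral_mul_const,
          integral_mul_const, hmean]
        simp
    _ ≤ α v S + meanReward g S v * β S + b ^ 2 * κ S := by
        have := mul_le_mul_of_nonneg_right hsq (hκ S)
        linarith

end Integrals

/-! ### The algorithm and its regret -/

section Algorithm

variable {N K m : ℕ} {g : ℝ[X]} {B : ℝ}

/-- The cumulative estimates `∑_{s < t} X̂_s` of the rewards of all actions after `t` periods. -/
noncomputable def score (φ : Action N K → Fin m → ℝ) (μ : Action N K → ℝ) (η γ b : ℝ) :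
    (t : ℕ) → Observation N K t → Action N K → ℝ
  | 0, _ => 0
  | t + 1, o =>
    score φ μ η γ b t (fun s => o s.castSucc) +
      estimate φ b (sampling μ η γ (score φ μ η γ b t fun s => o s.castSucc))
        (o (Fin.last t)).1 (o (Fin.last t)).2

lemma measurable_score (φ : Action N K → Fin m → ℝ) (μ : Action N K → ℝ) (η γ b : ℝ) (t : ℕ) :
    Measurable (score φ μ η γ b t) := by
  induction t with
  | zero => exact measurable_const
  | succ t ih =>
    have h1 : Measurable fun o : Observation N K (t + 1) =>
        score φ μ η γ b t fun s => o s.castSucc :=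
      ih.comp (measurable_pi_lambda _ fun s => measurable_pi_apply s.castSucc)
    have h2 : Measurable fun o : Observation N K (t + 1) => o (Fin.last t) := measurable_pi_apply _
    exact h1.add (measurable_estimate φ b (measurable_sampling μ η γ h1) h2.fst h2.snd)

lemma score_append (φ : Action N K → Fin m → ℝ) (μ : Action N K → ℝ) (η γ b : ℝ) (t : ℕ)
    (h : History N K t) (x : Round N K) :
    score φ μ η γ b (t + 1) (observe (append (h, x))) = score φ μ η γ b t (observe h) +
      estimate φ b (sampling μ η γ (score φ μ η γ b t (observe h))) x.1.2 x.2 := by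
  have h1 : (fun s : Fin t => observe (append (h, x)) s.castSucc) = observe h := by
    funext s
    simp [observe, append]
  have h2 : observe (append (h, x)) (Fin.last t) = (x.1.2, x.2) := by
    simp [observe, append]
  rw [score, h1, h2]

lemma abs_score_le {φ : Action N K → Fin m → ℝ} {μ : Action N K → ℝ} {η γ b : ℝ}
    (hest : ∀ w S r a, |η * estimate φ b (sampling μ η γ w) S r a| ≤ 1) (t : ℕ)
    (o : Observation N K t) (a : Action N K) : |η * score φ μ η γ b t o a| ≤ t := by
  induction t with
  | zero => simp [score]
  | succ t ih =>
    rw [score, Pi.add_apply, mul_add, Nat.cast_succ]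
    exact (abs_add_le _ _).trans (add_le_add (ih _) (hest _ _ _ _))

/-- Expected regret of exponential weights with exploration, for any policy that draws its actions
from `sampling`. The regret plus the nonnegative logarithmic potential drifts upwards by at most
`γ + 2 η b² m` in each period. -/
lemma regretAgainst_le [Nonempty (Action N K)]
    (hg : ∀ x ∈ Set.Icc (0 : ℝ) K, g.eval x ∈ Set.Icc (0 : ℝ) 1)
    {φ : Action N K → Fin m → ℝ} (hφ : ∀ c, (∀ S, c ⬝ᵥ φ S = 0) → c = 0)
    (hlin : ∀ v : RewardVec N, ∃ c, ∀ S, meanReward g S v = c ⬝ᵥ φ S)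
    {μ : Action N K → ℝ} (hμ : μ ∈ stdSimplex ℝ (Action N K)) (hμdet : IsUnit (design φ μ).det)
    (hμle : ∀ a, repKernel φ μ a a ≤ m) {η γ b : ℝ} (hη : 0 < η) (hγ : 0 < γ) (hγ1 : γ ≤ 1 / 2)
    (hb : 0 ≤ b) (hBb : B ≤ b) (hηγ : η * b * m ≤ γ) (π : Policy N K)
    (hπ : ∀ t o (f : Action N K → ℝ), ∫ S, f S ∂(π.action t o)
      = ∑ S, sampling μ η γ (score φ μ η γ b t o) S * f S)
    (𝒜 : Adversary N K g B) (T : ℕ) (S₀ : Action N K) :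
    regretAgainst π 𝒜 T S₀ ≤
      η⁻¹ * Real.log (Fintype.card (Action N K)) + T * (γ + 2 * η * b ^ 2 * m) := by
  have hest : ∀ w S r a, |η * estimate φ b (sampling μ η γ w) S r a| ≤ 1 := fun w S r a => by
    have h1 := abs_repKernel_sampling_le (η := η) hφ hμ hμdet hμle hγ (by linarith) w a S
    rw [estimate, abs_mul, abs_mul, abs_of_pos hη]
    calc η * (|clip b r| * |repKernel φ (sampling μ η γ w) a S|) ≤ η * (b * (m / γ)) := by
          gcongr
          exact abs_clip_le hb r
      _ = η * b * m / γ := by ring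
      _ ≤ 1 := (div_le_one hγ).2 hηγ
  set W : ∀ t, History N K t → Action N K → ℝ := fun t h => score φ μ η γ b t (observe h) with hW
  have hWm : ∀ t, Measurable (W t) := fun t =>
    (measurable_score φ μ η γ b t).comp measurable_observe
  have hWabs : ∀ t h a, |η * W t h a| ≤ t := fun t h a => abs_score_le hest t _ a
  set D : ∀ t, History N K t → ℝ := fun t h =>
    ∑ s : Fin t, (meanReward g S₀ (h s).1.1 - meanReward g (h s).1.2 (h s).1.1) with hD
  have hDm : ∀ t, Measurable (D t) := fun t =>
    Finset.measurable_fun_sum _ fun s _ => by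
      have h1 : Measurable fun h : History N K t => h s := measurable_pi_apply s
      exact ((measurable_meanReward g).comp (measurable_const.prodMk h1.fst.fst)).sub
        ((measurable_meanReward g).comp (h1.fst.snd.prodMk h1.fst.fst))
  have hDabs : ∀ t h, |D t h| ≤ t := fun t h => by
    calc |D t h| ≤ ∑ s : Fin t, |meanReward g S₀ (h s).1.1 - meanReward g (h s).1.2 (h s).1.1| :=
          Finset.abs_sum_le_sum_abs _ _
      _ ≤ ∑ _s : Fin t, (1 : ℝ) := Finset.sum_le_sum fun s _ => abs_meanReward_sub_le hg _ _ _
      _ = t := by simp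
  -- the potential: the logarithm of the total weight over the weight of `S₀`
  set P : ∀ t, History N K t → ℝ := fun t h => logWeight η (W t h) - η * W t h S₀ with hP
  have hPm : ∀ t, Measurable (P t) := fun t =>
    (measurable_logWeight η (hWm t)).sub (((measurable_pi_apply S₀).comp (hWm t)).const_mul η)
  have hP0 : ∀ t h, 0 ≤ P t h := fun t h => sub_nonneg.2 (le_logWeight η _ S₀)
  have hPle : ∀ t h, P t h ≤ Real.log (Fintype.card (Action N K)) + t + t := fun t h => by
    have h1 := logWeight_le (C := t) fun a => (abs_le.1 (hWabs t h a)).2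
    have h2 := (abs_le.1 (hWabs t h S₀)).1
    simp only [hP]
    linarith
  have hZm : ∀ t, Measurable fun h => D t h + η⁻¹ * P t h := fun t =>
    (hDm t).add ((hPm t).const_mul _)
  have hZabs : ∀ t h, |D t h + η⁻¹ * P t h| ≤
      t + η⁻¹ * (Real.log (Fintype.card (Action N K)) + t + t) := fun t h => by
    refine (abs_add_le _ _).trans (add_le_add (hDabs t h) ?_)
    rw [abs_of_nonneg (mul_nonneg (by positivity) (hP0 t h))]
    exact mul_le_mul_of_nonneg_left (hPle t h) (by positivity)
  have hdrift := integral_law_le π 𝒜 (fun t h => D t h + η⁻¹ * P t h) hZm _ hZabs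
    (γ + 2 * η * b ^ 2 * m) ?_ T
  · calc regretAgainst π 𝒜 T S₀ ≤ ∫ h, (D T h + η⁻¹ * P T h) ∂(law π 𝒜 T) := by
          refine integral_mono (integrable_of_abs_le (hDm T) (hDabs T))
            (integrable_of_abs_le (hZm T) (hZabs T)) fun h => ?_
          exact le_add_of_nonneg_right (mul_nonneg (by positivity) (hP0 T h))
      _ ≤ _ := hdrift
      _ = _ := by simp [hD, hP, hW, score, logWeight]
  intro t h
  set w := W t h with hw
  set p := sampling μ η γ w with hp
  have hWapp : ∀ x, W (t + 1) (append (h, x)) = w + estimate φ b p x.1.2 x.2 := fun x =>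
    score_append φ μ η γ b t h x
  have hDapp : ∀ x, D (t + 1) (append (h, x))
      = D t h + (meanReward g S₀ x.1.1 - meanReward g x.1.2 x.1.1) := fun x => by
    simp [hD, Fin.sum_univ_castSucc, append]
    ring
  refine integral_nextRound_le π 𝒜 t h (p := p) (b := b)
    (C := ((t + 1 : ℕ) + η⁻¹ * (Real.log (Fintype.card (Action N K)) + (t + 1 : ℕ) + (t + 1 : ℕ)))
      + (t + η⁻¹ * (Real.log (Fintype.card (Action N K)) + t + t)))
    (α := fun v S => meanReward g S₀ v - meanReward g S v)
    (β := fun S => ∑ a, softmax η w a * repKernel φ p a S - repKernel φ p S₀ S)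
    (κ := fun S => η * ∑ a, softmax η w a * repKernel φ p a S ^ 2)
    (fun S => (sampling_pos hμ hγ.le (by linarith) w S).le) (fun f => hπ t _ f)
    (((hZm (t + 1)).comp (measurable_append.comp measurable_prodMk_left)).sub measurable_const)
    (fun x => (abs_sub _ _).trans (add_le_add (hZabs _ _) (hZabs _ _))) hb hBb
    (fun S => mul_nonneg hη.le (Finset.sum_nonneg fun a _ =>
      mul_nonneg (softmax_pos η w a).le (sq_nonneg _))) (fun v S r => ?_) (by positivity)
    (fun v => sum_sampling_mul_le hφ hμ hγ.le hγ1 hη.le w (hlin v)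
      (fun S => (meanReward_mem_Icc hg S v).1) (fun S => (meanReward_mem_Icc hg S v).2) S₀)
  have hlog := logWeight_add_le w (estimate φ b p S r) (hest w S r)
  have e1 : ∑ a, softmax η w a * estimate φ b p S r a
      = clip b r * ∑ a, softmax η w a * repKernel φ p a S := by
    rw [Finset.mul_sum]
    exact Finset.sum_congr rfl fun a _ => by rw [estimate]; ring
  have e2 : ∑ a, softmax η w a * estimate φ b p S r a ^ 2
      = clip b r ^ 2 * ∑ a, softmax η w a * repKernel φ p a S ^ 2 := by
    rw [Finset.mul_sum]
    exact Finset.sum_congr rfl fun a _ => by rw [estimate]; ring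
  rw [e1, e2] at hlog
  have hPapp : P (t + 1) (append (h, ((v, S), r))) ≤ P t h
      + η * (clip b r * (∑ a, softmax η w a * repKernel φ p a S - repKernel φ p S₀ S)
        + clip b r ^ 2 * (η * ∑ a, softmax η w a * repKernel φ p a S ^ 2)) := by
    simp only [hP, hWapp]
    rw [Pi.add_apply, estimate]
    linarith
  have hPapp' := mul_le_mul_of_nonneg_left hPapp (inv_nonneg.2 hη.le)
  rw [mul_add, inv_mul_cancel_left₀ hη.ne'] at hPapp'
  change D (t + 1) (append (h, ((v, S), r))) + η⁻¹ * P (t + 1) (append (h, ((v, S), r)))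
    - (D t h + η⁻¹ * P t h) ≤ _
  rw [hDapp]
  linarith

lemma regretAgainst_le_card (hg : ∀ x ∈ Set.Icc (0 : ℝ) K, g.eval x ∈ Set.Icc (0 : ℝ) 1)
    (π : Policy N K) (𝒜 : Adversary N K g B) (T : ℕ) (S₀ : Action N K) :
    regretAgainst π 𝒜 T S₀ ≤ T := by
  refine integral_le_of_forall_le T.cast_nonneg fun h => ?_
  calc ∑ t : Fin T, (meanReward g S₀ (h t).1.1 - meanReward g (h t).1.2 (h t).1.1)
      ≤ ∑ _t : Fin T, (1 : ℝ) :=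
        Finset.sum_le_sum fun t _ => (le_abs_self _).trans (abs_meanReward_sub_le hg _ _ _)
    _ = T := by simp

lemma regretAgainst_eq_zero [Subsingleton (Action N K)] (π : Policy N K) (𝒜 : Adversary N K g B)
    (T : ℕ) (S₀ : Action N K) : regretAgainst π 𝒜 T S₀ = 0 := by
  have h : ∀ S, S = S₀ := fun S => Subsingleton.elim _ _
  simp [regretAgainst, h]

lemma subsingleton_action (h : K = 0 ∨ K = N) : Subsingleton (Action N K) := by
  rw [← Fintype.card_le_one_iff_subsingleton, Fintype.card_finset_len, Fintype.card_fin]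
  rcases h with rfl | rfl <;> simp

lemma nonempty_policy [Nonempty (Action N K)] : Nonempty (Policy N K) := by
  obtain ⟨π, -⟩ := exists_policy (N := N) (K := K)
    (fun _ _ _ => (Fintype.card (Action N K) : ℝ)⁻¹) (fun _ => measurable_const)
    (fun _ _ _ => by positivity) fun _ _ => by
      rw [Finset.sum_const, Finset.card_univ, nsmul_eq_mul,
        mul_inv_cancel₀ (Nat.cast_ne_zero.2 Fintype.card_ne_zero)]
  exact ⟨π⟩

/-- In the range of `T` where it is better than the trivial bound, the rate `√(N^d T K log N)` is
attained, with learning rate `K log N / (b s)` and exploration rate `s / T`, where `s` is the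
rate. -/
lemma exists_policy_regretAgainst_le [Nonempty (Action N K)] (hK : K ≠ 0) (hN : 1 < N) (B : ℝ)
    (hg : ∀ x ∈ Set.Icc (0 : ℝ) K, g.eval x ∈ Set.Icc (0 : ℝ) 1) (T : ℕ) {s : ℝ}
    (hs : s = √((N : ℝ) ^ g.natDegree * T * (K * Real.log N))) (hT : 2 * s < T) :
    ∃ π : Policy N K, ∀ (𝒜 : Adversary N K g B) (S₀ : Action N K),
      regretAgainst π 𝒜 T S₀ ≤ 4 * max 1 B * s := by
  obtain ⟨m, hm, φ, hφ, hlin⟩ := exists_features (N := N) hK g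
  obtain ⟨μ, hμ, hμdet, hμle⟩ := exists_design_repKernel_le hφ
  set b := max 1 B with hb
  have hb1 : 1 ≤ b := le_max_left _ _
  set D : ℝ := (N : ℝ) ^ g.natDegree with hD
  set L : ℝ := K * Real.log N with hL
  have hmD : (m : ℝ) ≤ D := by
    rw [hD]
    exact_mod_cast hm
  have hN' : (1 : ℝ) < N := by exact_mod_cast hN
  have hDpos : 0 < D := by positivity
  have hLpos : 0 < L :=
    mul_pos (by exact_mod_cast Nat.pos_of_ne_zero hK) (Real.log_pos hN')
  have hTpos : (0 : ℝ) < T := lt_of_le_of_lt (by rw [hs]; positivity) hT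
  have hspos : 0 < s := by
    rw [hs]
    positivity
  have hsq : s * s = D * T * L := by
    rw [hs]
    exact Real.mul_self_sqrt (by positivity)
  set η := L / (b * s) with hη
  set γ := s / T with hγ
  have hηpos : 0 < η := by positivity
  have hγpos : 0 < γ := by positivity
  have hγ1 : γ ≤ 1 / 2 := by
    rw [hγ, div_le_iff₀ hTpos]
    linarith
  have hηD : η * b * D = γ := by
    rw [hη, hγ]
    field_simp
    linarith
  have hηγ : η * b * m ≤ γ := by
    rw [← hηD]
    gcongr
  obtain ⟨π, hπ⟩ := exists_policy
    (fun t o => sampling μ η γ (score φ μ η γ b t o))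
    (fun t => measurable_sampling μ η γ (measurable_score φ μ η γ b t))
    (fun t o S => (sampling_pos hμ hγpos.le (by linarith) _ S).le)
    (fun t o => sum_sampling hμ _)
  refine ⟨π, fun 𝒜 S₀ => ?_⟩
  calc regretAgainst π 𝒜 T S₀
      ≤ η⁻¹ * Real.log (Fintype.card (Action N K)) + T * (γ + 2 * η * b ^ 2 * m) :=
        regretAgainst_le hg hφ hlin hμ hμdet hμle hηpos hγpos hγ1 (by linarith)
          (le_max_right _ _) hηγ π hπ 𝒜 T S₀
    _ ≤ η⁻¹ * L + T * (γ + 2 * b * γ) := by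
        have h1 := mul_le_mul_of_nonneg_left hηγ (by linarith : 0 ≤ 2 * b)
        have h2 := mul_le_mul_of_nonneg_left (log_card_action_le N K) (inv_nonneg.2 hηpos.le)
        have h3 : γ + 2 * η * b ^ 2 * m ≤ γ + 2 * b * γ := by linarith
        exact add_le_add h2 (mul_le_mul_of_nonneg_left h3 hTpos.le)
    _ = b * s + s + 2 * b * s := by
        rw [hη, hγ]
        field_simp
        ring
    _ ≤ 4 * b * s := by nlinarith

end Algorithm
end CombBandit

theorem proposition3 :
    ∃ c : ℝ, 0 < c ∧
      ∀ (K d : ℕ) (g : ℝ[X]) (B : ℝ), g.natDegree = d →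
        (∀ x ∈ Set.Icc (0 : ℝ) K, g.eval x ∈ Set.Icc (0 : ℝ) 1) →
        ∀ N T : ℕ, K ≤ N →
          ∃ π : CombBandit.Policy N K, ∀ 𝒜 : CombBandit.Adversary N K g B,
            CombBandit.regret π 𝒜 T ≤
              (c * max 1 B * √(K : ℝ)) *
                min (T : ℝ) (√((N : ℝ) ^ d * (T : ℝ) * Real.log (N : ℝ))) := by
  refine ⟨4, by norm_num, ?_⟩
  rintro K _ g B rfl hg N T hKN
  have : Nonempty (CombBandit.Action N K) := by
    rw [← Fintype.card_pos_iff, Fintype.card_finset_len, Fintype.card_fin]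
    exact Nat.choose_pos hKN
  have hb : (1 : ℝ) ≤ max 1 B := le_max_left _ _
  by_cases hKN' : K = 0 ∨ K = N
  · have := CombBandit.subsingleton_action hKN'
    obtain ⟨π⟩ := CombBandit.nonempty_policy (N := N) (K := K)
    refine ⟨π, fun 𝒜 => ciSup_le fun S₀ => ?_⟩
    rw [CombBandit.regretAgainst_eq_zero]
    positivity
  rw [not_or] at hKN'
  have hK : (1 : ℝ) ≤ √(K : ℝ) :=
    Real.one_le_sqrt.2 (by exact_mod_cast Nat.one_le_iff_ne_zero.2 hKN'.1)
  have hN : 1 < N := by omega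
  set s := √((N : ℝ) ^ g.natDegree * T * (K * Real.log N)) with hs
  have hs' : √(K : ℝ) * √((N : ℝ) ^ g.natDegree * T * Real.log N) = s := by
    rw [← Real.sqrt_mul K.cast_nonneg, hs]
    congr 1
    ring
  have hs0 : 0 ≤ s := Real.sqrt_nonneg _
  -- It remains to bound the regret by the rate `s`, as the bound by `T` holds for every policy.
  suffices h : ∃ π : CombBandit.Policy N K, ∀ (𝒜 : CombBandit.Adversary N K g B) S₀,
      CombBandit.regretAgainst π 𝒜 T S₀ ≤ 4 * max 1 B * s by
    obtain ⟨π, hπ⟩ := h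
    refine ⟨π, fun 𝒜 => ciSup_le fun S₀ => ?_⟩
    rw [mul_min_of_nonneg _ _ (by positivity), mul_assoc (4 * max 1 B) _ (√_), hs']
    refine le_min ((CombBandit.regretAgainst_le_card hg π 𝒜 T S₀).trans ?_) (hπ 𝒜 S₀)
    have h1 : 1 ≤ 4 * max 1 B * √(K : ℝ) := by nlinarith
    nlinarith [T.cast_nonneg (α := ℝ)]
  rcases lt_or_ge (2 * s) T with hT | hT
  · exact CombBandit.exists_policy_regretAgainst_le hKN'.1 hN B hg T hs hT
  · obtain ⟨π⟩ := CombBandit.nonempty_policy (N := N) (K := K)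
    refine ⟨π, fun 𝒜 S₀ => (CombBandit.regretAgainst_le_card hg π 𝒜 T S₀).trans ?_⟩
    nlinarith
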